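/- Theorem ($H(\operatorname{Curl})$-nonconformity of $V_{h,k}^{\mathrm{sym\,Curl}}$). Let $\Omega\subset\mathbb R^3$ be open and connected, and let $\mathcal T$ be a conforming tetrahedral grid of $\Omega$, i.e. a finite simplicial complex in which every simplex is a face of a tetrahedron and whose tetrahedra (the elements of $\mathcal T$) cover exactly $\overline\Omega$. For every face $F$ of the grid fix a unit normal $n_F$ and two vectors $a_{F,1},a_{F,2}$ such that $a_{F,1},a_{F,2},n_F$ are linearly independent; for every edge $E$ fix a unit tangent $t_E$ and two unit vectors $n_{E,1},n_{E,2}$ spanning the plane orthogonal to $E$. For an edge $E$ of a face $F$ put $\partial_{E,F}=t_E\times n_F$. For $k\ge 1$ let $V_{h,k}^{\mathrm{sym\,Curl}}$ be the set of all $U\in L^2(\Omega;\mathbb R^{3\times 3})$ that coincide on each element $T$ with an $\mathbb R^{3\times3}$-valued polynomial $U_T$ of degree at most $k$, and for which the following quantities coincide: (a) for elements sharing a vertex $v$: the entries $U_T(v)_{ij}$, $i\neq j$, and the differences $U_T(v)_{11}-U_T(v)_{22}$ and $U_T(v)_{22}-U_T(v)_{33}$; (b) for elements sharing an edge $E$,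 at each order-$k$ Lagrange point $L$ in the interior of $E$: $n_{E,1}^T U_T(L)\,t_E$ and $n_{E,2}^T U_T(L)\,t_E$; and, for each face $F$ bordering $E$ that belongs to both elements, $t_E^T U_T(L)(n_F\times t_E)$, $n_F^T U_T(L)(n_F\times t_E)$ and $t_E^T U_T(L)(n_F\times\partial_{E,F})+\partial_{E,F}^T U_T(L)(n_F\times t_E)$; (c) for elements sharing a face $F$, at each order-$k$ Lagrange point $L$ in the interior of $F$, writing $n=n_F$, $a_i=a_{F,i}$: $a_1^T U_T(L)(n\times a_1)$, $a_2^T U_T(L)(n\times a_2)$, $a_1^T U_T(L)(n\times a_2)+a_2^T U_T(L)(n\times a_1)$, $n^T U_T(L)(n\times a_1)$ and $n^T U_T(L)(n\times a_2)$. Let $H(\operatorname{Curl})$ be the space of all $U\in L^2(\Omega;\mathbb R^{3\times3})$ whose distributional row-wise curl belongs to $L^2(\Omega;\mathbb R^{3\times3})$. If $k\ge1$ and $\mathcal T$ has more than one element, then there is $U_h\in V_{h,k}^{\mathrm{sym\,Curl}}$ with $U_h\notin H(\operatorname{Curl})$. More precisely, for every element $T$ of $\mathcal T$, the function that is the identity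 matrix on $T$ and zero elsewhere belongs to $V_{h,k}^{\mathrm{sym\,Curl}}$ but not to $H(\operatorname{Curl})$. -/

import Mathlib

open MeasureTheory
open scoped Matrix ContDiff

noncomputable section

/-- Three-dimensional space in coordinates. Only the topology, the smooth structure, Lebesgue
measure and the dot and cross products are used below; the norm of this type is not. -/
abbrev R3 : Type := Fin 3 → ℝ

/-- Real `3 × 3` matrices. -/
abbrev Mat3 : Type := Matrix (Fin 3) (Fin 3) ℝ

/-! ### The space `H(Curl)` -/

/-- The classical `curl` of a vector field. -/
def curl (Φ : R3 → R3) (x : R3) : R3 :=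
  let D : Fin 3 → Fin 3 → ℝ := fun a b => fderiv ℝ Φ x (Pi.single a 1) b
  ![D 1 2 - D 2 1, D 2 0 - D 0 2, D 0 1 - D 1 0]

/-- `g` is the distributional `curl` of the vector field `u` on the open set `Ω`:
`∫_Ω g · Φ = ∫_Ω u · curl Φ` for all smooth `Φ` with compact support in `Ω`. -/
def IsWeakCurl (Ω : Set R3) (u g : R3 → R3) : Prop :=
  ∀ Φ : R3 → R3, ContDiff ℝ ∞ Φ → HasCompactSupport Φ → tsupport Φ ⊆ Ω →
    ∫ x in Ω, g x ⬝ᵥ Φ x = ∫ x in Ω, u x ⬝ᵥ curl Φ x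

/-- `L²(Ω; ℝ^{3×3})`, as a set of functions. -/
def L2Mat (Ω : Set R3) : Set (R3 → Mat3) :=
  {U | ∀ i j, MemLp (fun x => U x i j) 2 (volume.restrict Ω)}

/-- `H(Curl)` on `Ω`: square-integrable matrix fields whose distributional `Curl`, that is `curl`
applied to each row, is square-integrable. -/
def HCurl (Ω : Set R3) : Set (R3 → Mat3) :=
  {U | U ∈ L2Mat Ω ∧ ∃ G ∈ L2Mat Ω, ∀ i : Fin 3, IsWeakCurl Ω (fun x => U x i) (fun x => G x i)}

/-! ### Tetrahedral grids -/

/-- The simplicial complex `K` is a conforming tetrahedral grid of `Ω`: it is finite, each of its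
simplices is a face of a tetrahedron of `K`, and its tetrahedra cover exactly the closure
of `Ω`. -/
structure IsTetrahedralGrid (K : Geometry.SimplicialComplex ℝ R3) (Ω : Set R3) : Prop where
  finite : K.faces.Finite
  pure : ∀ S ∈ K.faces, ∃ T ∈ K.faces, S ⊆ T ∧ T.card = 4
  space_eq : K.space = closure Ω

/-- The elements of a grid, each given by its four vertices. The tetrahedron itself is
`convexHull ℝ T`. -/
def gridElements (K : Geometry.SimplicialComplex ℝ R3) : Set (Finset R3) :=
  {T | T ∈ K.faces ∧ T.card = 4}

/-- The triangular faces of a grid, each given by its three vertices. -/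
def gridFaces (K : Geometry.SimplicialComplex ℝ R3) : Set (Finset R3) :=
  {F | F ∈ K.faces ∧ F.card = 3}

/-- The edges of a grid, each given by its two vertices. -/
def gridEdges (K : Geometry.SimplicialComplex ℝ R3) : Set (Finset R3) :=
  {E | E ∈ K.faces ∧ E.card = 2}

/-- The Lagrange points of order `k` in the relative interior of the simplex with vertex set `S`:
the points all of whose barycentric coordinates are positive integer multiples of `1 / k`. -/
def innerLagrangePoints (k : ℕ) (S : Finset R3) : Set R3 :=
  {x | ∃ m : R3 → ℕ, (∀ v ∈ S, 0 < m v) ∧ ∑ v ∈ S, m v = k ∧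
    x = ∑ v ∈ S, ((m v : ℝ) / (k : ℝ)) • v}

/-- The vectors that are fixed once and for all for the faces and edges of a grid. -/
structure GridFrame (K : Geometry.SimplicialComplex ℝ R3) where
  /-- unit normal of a face -/
  normal : Finset R3 → R3
  /-- first auxiliary vector of a face -/
  a₁ : Finset R3 → R3
  /-- second auxiliary vector of a face -/
  a₂ : Finset R3 → R3
  /-- unit tangent of an edge -/
  tangent : Finset R3 → R3
  /-- first unit normal of an edge -/
  edgeNormal₁ : Finset R3 → R3
  /-- second unit normal of an edge -/
  edgeNormal₂ : Finset R3 → R3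
  normal_unit : ∀ F ∈ gridFaces K, normal F ⬝ᵥ normal F = 1
  normal_orthogonal : ∀ F ∈ gridFaces K, ∀ d ∈ vectorSpan ℝ (F : Set R3), normal F ⬝ᵥ d = 0
  face_independent : ∀ F ∈ gridFaces K, LinearIndependent ℝ ![a₁ F, a₂ F, normal F]
  tangent_unit : ∀ E ∈ gridEdges K, tangent E ⬝ᵥ tangent E = 1
  tangent_mem : ∀ E ∈ gridEdges K, tangent E ∈ vectorSpan ℝ (E : Set R3)
  edgeNormal₁_unit : ∀ E ∈ gridEdges K, edgeNormal₁ E ⬝ᵥ edgeNormal₁ E = 1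
  edgeNormal₂_unit : ∀ E ∈ gridEdges K, edgeNormal₂ E ⬝ᵥ edgeNormal₂ E = 1
  edgeNormal_span : ∀ E ∈ gridEdges K, ∀ d : R3,
    d ∈ Submodule.span ℝ {edgeNormal₁ E, edgeNormal₂ E} ↔ tangent E ⬝ᵥ d = 0

/-! ### Degrees of freedom that are shared between elements

All of them are directional point evaluations; the argument `A` is the value `U(L)` at the point. -/

/-- Vertex degrees of freedom: the off-diagonal entries. -/
def vertexOffDiagonalDofs (A : Mat3) : Fin 6 → ℝ :=
  ![A 0 1, A 0 2, A 1 0, A 1 2, A 2 0, A 2 1]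

/-- Vertex degrees of freedom: the differences of diagonal entries. -/
def vertexDiagonalDofs (A : Mat3) : Fin 2 → ℝ :=
  ![A 0 0 - A 1 1, A 1 1 - A 2 2]

/-- Edge degrees of freedom, for an edge with tangent `t` and edge normals `n₁`, `n₂`. -/
def edgeDofs (t n₁ n₂ : R3) (A : Mat3) : Fin 2 → ℝ :=
  ![n₁ ⬝ᵥ (A *ᵥ t), n₂ ⬝ᵥ (A *ᵥ t)]

/-- Edge degrees of freedom associated with an adjacent face, for an edge with tangent `t` and a
face with normal `n`. The conormal is `t ⨯₃ n`, so that `n ⨯₃ (t ⨯₃ n) = t`. -/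
def edgeFaceDofs (t n : R3) (A : Mat3) : Fin 3 → ℝ :=
  ![t ⬝ᵥ (A *ᵥ (n ⨯₃ t)),
    n ⬝ᵥ (A *ᵥ (n ⨯₃ t)),
    t ⬝ᵥ (A *ᵥ (n ⨯₃ (t ⨯₃ n))) + (t ⨯₃ n) ⬝ᵥ (A *ᵥ (n ⨯₃ t))]

/-- Face degrees of freedom, for a face with normal `n` and auxiliary vectors `a₁`, `a₂`. -/
def faceDofs (a₁ a₂ n : R3) (A : Mat3) : Fin 5 → ℝ :=
  ![a₁ ⬝ᵥ (A *ᵥ (n ⨯₃ a₁)),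
    a₂ ⬝ᵥ (A *ᵥ (n ⨯₃ a₂)),
    a₁ ⬝ᵥ (A *ᵥ (n ⨯₃ a₂)) + a₂ ⬝ᵥ (A *ᵥ (n ⨯₃ a₁)),
    n ⬝ᵥ (A *ᵥ (n ⨯₃ a₁)),
    n ⬝ᵥ (A *ᵥ (n ⨯₃ a₂))]

/-! ### The finite element space -/

/-- Matrices of polynomials in three variables. -/
abbrev PolyMat : Type := Matrix (Fin 3) (Fin 3) (MvPolynomial (Fin 3) ℝ)

/-- The value of a matrix polynomial at a point. -/
def PolyMat.evalAt (P : PolyMat) (x : R3) : Mat3 :=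
  P.map (MvPolynomial.eval x)

/-- The coupling conditions between the polynomials `P` and `Q` living on the elements
`T` and `T'`. -/
structure Coupled {K : Geometry.SimplicialComplex ℝ R3} (fr : GridFrame K) (k : ℕ)
    (T T' : Finset R3) (P Q : PolyMat) : Prop where
  vertex_offDiagonal : ∀ v ∈ T, v ∈ T' →
    vertexOffDiagonalDofs (P.evalAt v) = vertexOffDiagonalDofs (Q.evalAt v)
  vertex_diagonal : ∀ v ∈ T, v ∈ T' →
    vertexDiagonalDofs (P.evalAt v) = vertexDiagonalDofs (Q.evalAt v)
  edge : ∀ E ∈ gridEdges K, E ⊆ T → E ⊆ T' → ∀ L ∈ innerLagrangePoints k E,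
    edgeDofs (fr.tangent E) (fr.edgeNormal₁ E) (fr.edgeNormal₂ E) (P.evalAt L) =
      edgeDofs (fr.tangent E) (fr.edgeNormal₁ E) (fr.edgeNormal₂ E) (Q.evalAt L)
  edge_face : ∀ E ∈ gridEdges K, ∀ F ∈ gridFaces K, E ⊆ F → F ⊆ T → F ⊆ T' →
    ∀ L ∈ innerLagrangePoints k E,
      edgeFaceDofs (fr.tangent E) (fr.normal F) (P.evalAt L) =
        edgeFaceDofs (fr.tangent E) (fr.normal F) (Q.evalAt L)
  face : ∀ F ∈ gridFaces K, F ⊆ T → F ⊆ T' → ∀ L ∈ innerLagrangePoints k F,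
    faceDofs (fr.a₁ F) (fr.a₂ F) (fr.normal F) (P.evalAt L) =
      faceDofs (fr.a₁ F) (fr.a₂ F) (fr.normal F) (Q.evalAt L)

/-- The finite element space `V_{h,k}^{sym Curl}`: square-integrable matrix fields on `Ω` that
agree on each element `T` (almost everywhere) with a polynomial `P T` of degree at most `k`, such
that the shared degrees of freedom of these polynomials coincide. -/
def VSymCurl (Ω : Set R3) (K : Geometry.SimplicialComplex ℝ R3) (fr : GridFrame K) (k : ℕ) :
    Set (R3 → Mat3) :=
  {U | U ∈ L2Mat Ω ∧ ∃ P : Finset R3 → PolyMat,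
    (∀ T ∈ gridElements K,
      (∀ i j, (P T i j).totalDegree ≤ k) ∧
      ∀ᵐ x ∂(volume.restrict Ω), x ∈ convexHull ℝ (T : Set R3) → U x = (P T).evalAt x) ∧
    ∀ T ∈ gridElements K, ∀ T' ∈ gridElements K, Coupled fr k T T' (P T) (P T')}

open Classical in
/-- The matrix field that is the identity matrix on the element `T` and zero elsewhere. -/
def identityOn (T : Finset R3) (x : R3) : Mat3 :=
  if x ∈ convexHull ℝ (T : Set R3) then 1 else 0

end

/-! ### Membership in the finite element space -/

/-! Every shared degree of freedom kills the identity matrix, so constant fields 1 and 0 may be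
mixed freely over the elements (`coupled_of_eq_one_or_zero`).

For nonmembership, suppose the identity on T had an L² weak curl. Testing away from the boundary of
T shows that it vanishes inside and outside T, hence almost everywhere, as the frontier of a convex
set is null (`ae_eq_zero_of_isWeakCurl_identityOn`). Now the i-th component of curl (φ c) is the
derivative of φ along c × e_i, and such vectors span space, so the indicator of T has zero weak
gradient on Ω. Mollification refutes this near a point of the frontier of T in Ω
(`exists_setIntegral_fderiv_ne_zero`). Connectedness and a second element supply that point
(`exists_mem_frontier_gridElement`). -/

lemma vertexOffDiagonalDofs_one : vertexOffDiagonalDofs 1 = 0 := by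
  ext i; fin_cases i <;> simp [vertexOffDiagonalDofs]

lemma vertexOffDiagonalDofs_zero : vertexOffDiagonalDofs 0 = 0 := by
  ext i; fin_cases i <;> simp [vertexOffDiagonalDofs]

lemma vertexDiagonalDofs_one : vertexDiagonalDofs 1 = 0 := by
  ext i; fin_cases i <;> simp [vertexDiagonalDofs]

lemma vertexDiagonalDofs_zero : vertexDiagonalDofs 0 = 0 := by
  ext i; fin_cases i <;> simp [vertexDiagonalDofs]

lemma edgeDofs_zero (t n₁ n₂ : R3) : edgeDofs t n₁ n₂ 0 = 0 := by
  ext i; fin_cases i <;> simp [edgeDofs]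

lemma edgeDofs_one {t n₁ n₂ : R3} (h₁ : t ⬝ᵥ n₁ = 0) (h₂ : t ⬝ᵥ n₂ = 0) :
    edgeDofs t n₁ n₂ 1 = 0 := by
  rw [dotProduct_comm] at h₁ h₂
  ext i; fin_cases i <;> simp [edgeDofs, h₁, h₂]

lemma edgeFaceDofs_zero (t n : R3) : edgeFaceDofs t n 0 = 0 := by
  ext i; fin_cases i <;> simp [edgeFaceDofs]

/-- For the identity every entry is a triple product u · (n × w) with a repeated vector, or its
symmetrization in u and w; antisymmetry makes it zero. The same reason serves `faceDofs_one`. -/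
lemma edgeFaceDofs_one (t n : R3) : edgeFaceDofs t n 1 = 0 := by
  ext i
  fin_cases i <;>
    simp [edgeFaceDofs, crossProduct, dotProduct, Fin.sum_univ_three] <;> ring

lemma faceDofs_zero (a₁ a₂ n : R3) : faceDofs a₁ a₂ n 0 = 0 := by
  ext i; fin_cases i <;> simp [faceDofs]

lemma faceDofs_one (a₁ a₂ n : R3) : faceDofs a₁ a₂ n 1 = 0 := by
  ext i
  fin_cases i <;>
    simp [faceDofs, crossProduct, dotProduct, Fin.sum_univ_three] <;> ring

lemma PolyMat.evalAt_one (x : R3) : PolyMat.evalAt 1 x = 1 := by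
  simp [PolyMat.evalAt]

lemma PolyMat.evalAt_zero (x : R3) : PolyMat.evalAt 0 x = 0 := by
  ext; simp [PolyMat.evalAt]

/-- All shared degrees of freedom of the identity matrix and of the zero matrix vanish, so any
two such constant fields are coupled. -/
lemma coupled_of_eq_one_or_zero {K : Geometry.SimplicialComplex ℝ R3} (fr : GridFrame K) (k : ℕ)
    (T T' : Finset R3) {P Q : PolyMat} (hP : P = 1 ∨ P = 0) (hQ : Q = 1 ∨ Q = 0) :
    Coupled fr k T T' P Q := by
  have hn₁ : ∀ E ∈ gridEdges K, fr.tangent E ⬝ᵥ fr.edgeNormal₁ E = 0 := fun E hE =>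
    (fr.edgeNormal_span E hE _).1 (Submodule.subset_span (by simp))
  have hn₂ : ∀ E ∈ gridEdges K, fr.tangent E ⬝ᵥ fr.edgeNormal₂ E = 0 := fun E hE =>
    (fr.edgeNormal_span E hE _).1 (Submodule.subset_span (by simp))
  constructor
  · intro v _ _
    rcases hP with rfl | rfl <;> rcases hQ with rfl | rfl <;>
      simp only [PolyMat.evalAt_one, PolyMat.evalAt_zero, vertexOffDiagonalDofs_one,
        vertexOffDiagonalDofs_zero]
  · intro v _ _
    rcases hP with rfl | rfl <;> rcases hQ with rfl | rfl <;>
      simp only [PolyMat.evalAt_one, PolyMat.evalAt_zero, vertexDiagonalDofs_one,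
        vertexDiagonalDofs_zero]
  · intro E hE _ _ L _
    rcases hP with rfl | rfl <;> rcases hQ with rfl | rfl <;>
      simp only [PolyMat.evalAt_one, PolyMat.evalAt_zero, edgeDofs_one (hn₁ E hE) (hn₂ E hE),
        edgeDofs_zero]
  · intro E _ F _ _ _ _ L _
    rcases hP with rfl | rfl <;> rcases hQ with rfl | rfl <;>
      simp only [PolyMat.evalAt_one, PolyMat.evalAt_zero, edgeFaceDofs_one, edgeFaceDofs_zero]
  · intro F _ _ _ L _
    rcases hP with rfl | rfl <;> rcases hQ with rfl | rfl <;>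
      simp only [PolyMat.evalAt_one, PolyMat.evalAt_zero, faceDofs_one, faceDofs_zero]

lemma isCompact_convexHull_finset (T : Finset R3) : IsCompact (convexHull ℝ (T : Set R3)) :=
  T.finite_toSet.isCompact_convexHull ℝ

/-- At most three points of space do not affinely span it. -/
lemma affineSpan_ne_top_of_card_le_three {S : Finset R3} (hS : S.card ≤ 3) :
    affineSpan ℝ (S : Set R3) ≠ ⊤ := by
  classical
  intro h
  have hne : S.Nonempty := by
    have : (S : Set R3).Nonempty := by
      rw [← affineSpan_nonempty ℝ, h]; exact ⟨0, trivial⟩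
    simpa using this
  have hv : vectorSpan ℝ (S : Set R3) = ⊤ := by
    rw [← direction_affineSpan, h, AffineSubspace.direction_top]
  -- Natural subtraction: this is where nonemptiness of S is needed.
  have hc : S.card = (S.card - 1) + 1 := (Nat.sub_add_cancel hne.card_pos).symm
  have := finrank_vectorSpan_image_finset_le ℝ (id : R3 → R3) S hc
  rw [Finset.image_id, hv, finrank_top, Module.finrank_fin_fun] at this
  omega

/-- Distinct elements of a grid overlap in a null set. -/
lemma volume_inter_gridElements_eq_zero {K : Geometry.SimplicialComplex ℝ R3} {T T' : Finset R3}
    (hT : T ∈ gridElements K) (hT' : T' ∈ gridElements K) (hne : T ≠ T') :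
    volume (convexHull ℝ (T : Set R3) ∩ convexHull ℝ (T' : Set R3)) = 0 := by
  classical
  have hlt : (T ∩ T').card ≤ 3 := by
    by_contra! hc
    have h1 : T ∩ T' = T := Finset.eq_of_subset_of_card_le Finset.inter_subset_left
      (by rw [hT.2]; omega)
    have h2 : T ∩ T' = T' := Finset.eq_of_subset_of_card_le Finset.inter_subset_right
      (by rw [hT'.2]; omega)
    exact hne (h1.symm.trans h2)
  -- In a simplicial complex the overlap lies in the hull of the common vertices, which are too few
  -- to span space.
  refine measure_mono_null ((K.inter_subset_convexHull hT.1 hT'.1).trans ?_)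
    (Measure.addHaar_affineSubspace volume _ (affineSpan_ne_top_of_card_le_three hlt))
  rw [← Finset.coe_inter]
  exact convexHull_subset_affineSpan _

/-- An element of a grid has interior points. -/
lemma nonempty_interior_gridElement {K : Geometry.SimplicialComplex ℝ R3} {T : Finset R3}
    (hT : T ∈ gridElements K) : (interior (convexHull ℝ (T : Set R3))).Nonempty := by
  rw [interior_convexHull_nonempty_iff_affineSpan_eq_top]
  have h := (K.indep hT.1).affineSpan_eq_top_iff_card_eq_finrank_add_one
  rw [Subtype.range_coe_subtype] at h
  refine h.2 ?_
  simp [hT.2]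

lemma identityOn_mem_L2Mat (Ω : Set R3) (T : Finset R3) : identityOn T ∈ L2Mat Ω := by
  classical
  intro i j
  have h : (fun x => identityOn T x i j) =
      (convexHull ℝ (T : Set R3)).indicator fun _ => (1 : Mat3) i j := by
    ext x
    by_cases hx : x ∈ convexHull ℝ (T : Set R3) <;> simp [identityOn, hx]
  have hc := isCompact_convexHull_finset T
  rw [h]
  exact memLp_indicator_const 2 hc.measurableSet _
    (Or.inr (((Measure.restrict_apply_le _ _).trans_lt hc.measure_lt_top).ne))

/-- The field that is the identity matrix on one element and zero elsewhere belongs to the finite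
element space, since the identity matrix is invisible to all shared degrees of freedom. -/
theorem identityOn_mem_VSymCurl (Ω : Set R3) {K : Geometry.SimplicialComplex ℝ R3}
    (fr : GridFrame K) (k : ℕ) {T : Finset R3} (hT : T ∈ gridElements K) :
    identityOn T ∈ VSymCurl Ω K fr k := by
  classical
  refine ⟨identityOn_mem_L2Mat Ω T, fun S => if S = T then 1 else 0, ?_, ?_⟩
  · intro S hS
    by_cases hST : S = T
    · subst hST
      refine ⟨fun i j => ?_, Filter.Eventually.of_forall fun x hx => ?_⟩
      · by_cases hij : i = j <;> simp [hij, Matrix.one_apply]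
      · simp [identityOn, hx, PolyMat.evalAt_one]
    -- Only almost everywhere: on the common part of the hulls of S and T the field is 1, while the
    -- polynomial on S is 0.
    · refine ⟨fun i j => by simp [hST], ae_restrict_of_ae ?_⟩
      filter_upwards [measure_eq_zero_iff_ae_notMem.1
        (volume_inter_gridElements_eq_zero hS hT hST)] with x hx hxS
      have : x ∉ convexHull ℝ (T : Set R3) := fun h => hx ⟨hxS, h⟩
      simp [identityOn, this, hST, PolyMat.evalAt_zero]
  · intro S _ S' _
    exact coupled_of_eq_one_or_zero fr k S S' (ite_eq_or_eq _ _ _) (ite_eq_or_eq _ _ _)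

/-! ### The indicator of a convex body has no square-integrable gradient -/

/-- A closed convex body with a boundary point `x` in the open set `Ω` is detected by first
derivatives of test functions: its indicator does not have vanishing weak gradient on `Ω`. -/
theorem exists_setIntegral_fderiv_ne_zero {S Ω : Set R3} (hS : IsClosed S) (hconv : Convex ℝ S)
    (hint : (interior S).Nonempty) (hΩ : IsOpen Ω) {x : R3} (hxΩ : x ∈ Ω) (hxS : x ∈ frontier S) :
    ∃ φ : R3 → ℝ, ContDiff ℝ ∞ φ ∧ HasCompactSupport φ ∧ tsupport φ ⊆ Ω ∧
      ∃ v : R3, ∫ y in S, fderiv ℝ φ y v ≠ 0 := by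
  by_contra! hzero
  obtain ⟨r, hr, hball⟩ := Metric.isOpen_iff.1 hΩ x hxΩ
  have hr2 : 0 < r / 2 := half_pos hr
  obtain ⟨a, haS, hax⟩ : ∃ a ∈ interior S, dist x a < r / 2 := by
    have : x ∈ closure (interior S) := by
      rw [hconv.closure_interior_eq_closure_of_nonempty_interior hint]
      exact frontier_subset_closure hxS
    exact Metric.mem_closure_iff.1 this _ hr2
  obtain ⟨b, hbS, hbx⟩ : ∃ b ∈ Sᶜ, dist x b < r / 2 := by
    have : x ∈ closure Sᶜ := by
      rw [frontier_eq_closure_inter_closure] at hxS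
      exact hxS.2
    exact Metric.mem_closure_iff.1 this _ hr2
  obtain ⟨εa, hεa, hεaS⟩ := Metric.isOpen_iff.1 isOpen_interior a haS
  obtain ⟨εb, hεb, hεbS⟩ := Metric.isOpen_iff.1 hS.isOpen_compl b hbS
  -- A bump of radius below ε sees only S from a and only the complement from b; centred in the ball
  -- of radius r / 2 about x, it stays inside Ω.
  set ε := min (r / 2) (min εa εb) with hε
  have hεpos : 0 < ε := lt_min hr2 (lt_min hεa hεb)
  let ψ : ContDiffBump (0 : R3) := ⟨ε / 4, ε / 2, by positivity, by linarith⟩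
  have hψ : ContDiff ℝ ∞ ψ := ψ.contDiff
  have hψ0 : ∀ w : R3, ε ≤ ‖w‖ → ψ w = 0 := fun w hw =>
    ψ.zero_of_le_dist (by rw [dist_zero_right]; change ε / 2 ≤ _; linarith)
  have hloc : LocallyIntegrable (S.indicator fun _ => (1 : ℝ)) (volume : Measure R3) :=
    (locallyIntegrable_const 1).indicator hS.measurableSet
  let L := ContinuousLinearMap.lsmul ℝ ℝ (E := ℝ)
  let F : R3 → ℝ := convolution (S.indicator fun _ => (1 : ℝ)) ψ L volume
  have hF : ∀ z, F z = ∫ t in S, ψ (z - t) := by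
    intro z
    rw [← integral_indicator hS.measurableSet]
    refine integral_congr_ae (Filter.Eventually.of_forall fun t => ?_)
    by_cases ht : t ∈ S <;> simp [ht, L]
  have hder : ∀ z, HasFDerivAt F
      (convolution (S.indicator fun _ => (1 : ℝ)) (fderiv ℝ ψ) (L.precompR R3) volume z) z :=
    fun z => ψ.hasCompactSupport.hasFDerivAt_convolution_right L hloc (hψ.of_le (by simp)) z
  -- The derivative of the mollified indicator at z is, up to sign, the integral over S of the
  -- derivative of the test function t ↦ ψ (z - t), so `hzero` applies.
  have hder0 : ∀ z ∈ Metric.ball x (r / 2),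
      convolution (S.indicator fun _ => (1 : ℝ)) (fderiv ℝ ψ) (L.precompR R3) volume z = 0 := by
    intro z hz
    ext v
    rw [convolution_precompR_apply L hloc (ψ.hasCompactSupport.fderiv ℝ)
      (hψ.continuous_fderiv (by simp))]
    have hφ : ContDiff ℝ ∞ fun t => ψ (z - t) := hψ.comp (contDiff_const.sub contDiff_id)
    have hsub : tsupport (fun t => ψ (z - t)) ⊆ Metric.closedBall z (ε / 2) := by
      refine closure_minimal (fun t ht => ?_) Metric.isClosed_closedBall
      by_contra hcon
      rw [Metric.mem_closedBall, not_le, dist_comm, dist_eq_norm] at hcon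
      exact ht (ψ.zero_of_le_dist (by rw [dist_zero_right]; exact hcon.le))
    have hcs : HasCompactSupport fun t => ψ (z - t) :=
      (isCompact_closedBall z (ε / 2)).of_isClosed_subset (isClosed_tsupport _) hsub
    have hsubΩ : tsupport (fun t => ψ (z - t)) ⊆ Ω := by
      refine hsub.trans (Set.Subset.trans (fun t ht => ?_) hball)
      rw [Metric.mem_closedBall] at ht
      rw [Metric.mem_ball] at hz ⊢
      have : ε ≤ r / 2 := min_le_left _ _
      linarith [dist_triangle t z x]
    have h := hzero _ hφ hcs hsubΩ v
    have hfd : ∀ t, fderiv ℝ (fun t => ψ (z - t)) t v = -(fderiv ℝ ψ (z - t) v) := by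
      intro t
      have h1 : HasFDerivAt (fun t : R3 => z - t) (-ContinuousLinearMap.id ℝ R3) t :=
        (hasFDerivAt_id t).const_sub z
      have h2 := ((hψ.differentiable (by simp)) (z - t)).hasFDerivAt.comp t h1
      have h3 : fderiv ℝ (fun t => ψ (z - t)) t = _ := h2.fderiv
      rw [h3]
      simp
    simp only [hfd, integral_neg, neg_eq_zero] at h
    rw [← integral_indicator hS.measurableSet] at h
    refine Eq.trans (integral_congr_ae (Filter.Eventually.of_forall fun t => ?_)) h
    by_cases ht : t ∈ S <;> simp [ht, L]
  -- The mollified indicator is constant on the ball, yet it is 0 at b and the full mass of ψ at a.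
  have hFab : F a = F b := by
    refine Metric.isOpen_ball.is_const_of_fderiv_eq_zero (convex_ball x (r / 2)).isPreconnected
      (fun z _ => (hder z).differentiableAt.differentiableWithinAt)
      (fun z hz => (hder z).fderiv.trans (hder0 z hz)) ?_ ?_
    · rwa [Metric.mem_ball, dist_comm]
    · rwa [Metric.mem_ball, dist_comm]
  have hFb : F b = 0 := by
    rw [hF]
    refine setIntegral_eq_zero_of_forall_eq_zero fun t ht => hψ0 _ ?_
    by_contra! hlt
    refine hεbS (a := t) ?_ ht
    rw [Metric.mem_ball, dist_comm, dist_eq_norm]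
    exact hlt.trans_le ((min_le_right _ _).trans (min_le_right _ _))
  have hFa : F a = ∫ t, ψ t := by
    rw [hF, ← integral_sub_left_eq_self (fun t => ψ t) volume a]
    refine setIntegral_eq_integral_of_forall_compl_eq_zero fun t ht => hψ0 _ ?_
    by_contra! hlt
    refine ht (interior_subset (hεaS ?_))
    rw [Metric.mem_ball, dist_comm, dist_eq_norm]
    exact hlt.trans_le ((min_le_right _ _).trans (min_le_left _ _))
  exact (ψ.integral_pos (μ := volume)).ne' (hFa.symm.trans (hFab.trans hFb))

/-! ### Distributional curl of the identity on one element -/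

lemma curl_eq_zero_of_notMem_tsupport {Φ : R3 → R3} {x : R3} (hx : x ∉ tsupport Φ) :
    curl Φ x = 0 := by
  have h : fderiv ℝ Φ x = 0 := fderiv_of_notMem_tsupport ℝ hx
  ext i
  fin_cases i <;> simp [curl, h]

lemma fderiv_smul_const_apply {φ : R3 → ℝ} (hφ : ContDiff ℝ ∞ φ) (c : R3) (x v : R3) (b : Fin 3) :
    fderiv ℝ (fun y => φ y • c) x v b = fderiv ℝ φ x v * c b := by
  rw [((hφ.differentiable (by simp) x).hasFDerivAt.smul_const c).fderiv]
  simp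

lemma integrable_fderiv_apply {φ : R3 → ℝ} (hφ : ContDiff ℝ ∞ φ) (hc : HasCompactSupport φ)
    (v : R3) : Integrable (fun x => fderiv ℝ φ x v) volume :=
  ((hφ.continuous_fderiv (by simp)).clm_apply continuous_const).integrable_of_hasCompactSupport
    (hc.fderiv_apply ℝ v)

lemma integral_fderiv_apply_eq_zero {φ : R3 → ℝ} (hφ : ContDiff ℝ ∞ φ) (hc : HasCompactSupport φ)
    (v : R3) : ∫ x, fderiv ℝ φ x v = 0 := by
  -- Integration by parts against the constant 1.
  have h := integral_mul_fderiv_eq_neg_fderiv_mul_of_integrable (μ := (volume : Measure R3))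
    (f := fun _ => (1 : ℝ)) (g := φ) (v := v) (by simp)
    (by simpa using integrable_fderiv_apply hφ hc v)
    (by simpa using hφ.continuous.integrable_of_hasCompactSupport hc)
    (fun x _ => differentiableAt_const _) (fun x _ => hφ.differentiable (by simp) x)
  simpa using h

/-- The components of the curl of `φ • c` are directional derivatives of `φ`. -/
lemma curl_smul_const_apply {φ : R3 → ℝ} (hφ : ContDiff ℝ ∞ φ) (c : R3) (x : R3) (i : Fin 3) :
    curl (fun y => φ y • c) x i = fderiv ℝ φ x (c ⨯₃ Pi.single i 1) := by
  have hlin : ∀ w : R3, fderiv ℝ φ x w = ∑ j, w j * fderiv ℝ φ x (Pi.single j 1) := by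
    intro w
    conv_lhs => rw [pi_eq_sum_univ' w]
    simp
  rw [hlin]
  fin_cases i <;>
    simp [curl, fderiv_smul_const_apply hφ, crossProduct, Fin.sum_univ_three] <;> ring

/-- Pairing a row of the identity on `T` with the curl of a test function. -/
lemma setIntegral_identityOn_dotProduct_curl {Ω : Set R3} (T : Finset R3)
    {φ : R3 → ℝ} (hφ : ContDiff ℝ ∞ φ) (hsupp : tsupport φ ⊆ Ω) (c : R3) (i : Fin 3) :
    ∫ x in Ω, identityOn T x i ⬝ᵥ curl (fun y => φ y • c) x =
      ∫ x in convexHull ℝ (T : Set R3), fderiv ℝ φ x (c ⨯₃ Pi.single i 1) := by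
  classical
  rw [setIntegral_eq_integral_of_forall_compl_eq_zero,
    ← integral_indicator (isCompact_convexHull_finset T).measurableSet]
  · refine integral_congr_ae (Filter.Eventually.of_forall fun x => ?_)
    by_cases hx : x ∈ convexHull ℝ (T : Set R3)
    · simp [identityOn, hx, ← curl_smul_const_apply hφ, Matrix.one_apply, dotProduct]
    · simp [identityOn, hx, dotProduct]
  · intro x hx
    rw [curl_eq_zero_of_notMem_tsupport, dotProduct_zero]
    exact fun h => hx (hsupp (tsupport_smul_subset_left φ (fun _ => c) h))

/-- A weak curl of a row of the identity on `T` vanishes almost everywhere. -/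
lemma ae_eq_zero_of_isWeakCurl_identityOn {Ω : Set R3} (hΩ : IsOpen Ω) (T : Finset R3) (i : Fin 3)
    {g : R3 → R3} (hg : ∀ j, MemLp (fun x => g x j) 2 (volume.restrict Ω))
    (h : IsWeakCurl Ω (fun x => identityOn T x i) g) :
    ∀ᵐ x ∂(volume.restrict Ω), g x = 0 := by
  set S := convexHull ℝ (T : Set R3) with hSdef
  have hS : IsClosed S := (isCompact_convexHull_finset T).isClosed
  -- Testing with φ e_j reduces the vanishing of g on V to that of the weak gradient of the
  -- indicator there, by the fundamental lemma of the calculus of variations.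
  have hvanish : ∀ V : Set R3, IsOpen V → V ⊆ Ω →
      (∀ φ : R3 → ℝ, ContDiff ℝ ∞ φ → HasCompactSupport φ → tsupport φ ⊆ V →
        ∀ v, ∫ x in S, fderiv ℝ φ x v = 0) → ∀ j, ∀ᵐ x, x ∈ V → g x j = 0 := by
    intro V hV hVΩ hzero j
    refine hV.ae_eq_zero_of_integral_contDiff_smul_eq_zero
      (LocallyIntegrableOn.mono_set (s := Ω) ?_ hVΩ) ?_
    · exact locallyIntegrableOn_of_locallyIntegrable_restrict
        ((hg j).locallyIntegrable (by norm_num))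
    · intro φ hφ hc hsupp
      have hsub := tsupport_smul_subset_left φ (fun _ => (Pi.single j 1 : R3))
      have := h (fun y => φ y • Pi.single j 1) (hφ.smul contDiff_const) hc.smul_right
        (hsub.trans (hsupp.trans hVΩ))
      rw [setIntegral_identityOn_dotProduct_curl T hφ (hsupp.trans hVΩ),
        hzero φ hφ hc hsupp, setIntegral_eq_integral_of_forall_compl_eq_zero] at this
      · simpa [mul_comm] using this
      · intro x hx
        have : φ x = 0 := image_eq_zero_of_notMem_tsupport fun h => hx (hVΩ (hsupp h))
        simp [this]
  have hin := hvanish (Ω ∩ interior S) (hΩ.inter isOpen_interior) Set.inter_subset_left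
    fun φ hφ hc hsupp v => by
      rw [setIntegral_eq_integral_of_forall_compl_eq_zero]
      · exact integral_fderiv_apply_eq_zero hφ hc v
      · intro x hx
        rw [fderiv_of_notMem_tsupport ℝ fun h => hx (interior_subset (hsupp h).2)]
        rfl
  have hout := hvanish (Ω ∩ Sᶜ) (hΩ.inter hS.isOpen_compl) Set.inter_subset_left
    fun φ hφ hc hsupp v => setIntegral_eq_zero_of_forall_eq_zero fun x hx => by
      rw [fderiv_of_notMem_tsupport ℝ fun h => (hsupp h).2 hx]
      rfl
  have hfr := measure_eq_zero_iff_ae_notMem.1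
    ((convex_convexHull ℝ (T : Set R3)).addHaar_frontier volume)
  rw [ae_restrict_iff' hΩ.measurableSet]
  filter_upwards [ae_all_iff.2 hin, ae_all_iff.2 hout, hfr] with x h1 h2 h3 hx
  ext j
  by_cases hxS : x ∈ S
  · refine h1 j ⟨hx, ?_⟩
    by_contra hni
    exact h3 ⟨subset_closure hxS, hni⟩
  · exact h2 j ⟨hx, hxS⟩

/-- If the identity on `T` were in `H(Curl)`, the indicator of the tetrahedron would have
vanishing weak gradient. -/
lemma setIntegral_fderiv_eq_zero_of_identityOn_mem_HCurl {Ω : Set R3} (hΩ : IsOpen Ω)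
    {T : Finset R3} (h : identityOn T ∈ HCurl Ω) {φ : R3 → ℝ} (hφ : ContDiff ℝ ∞ φ)
    (hc : HasCompactSupport φ) (hsupp : tsupport φ ⊆ Ω) (v : R3) :
    ∫ x in convexHull ℝ (T : Set R3), fderiv ℝ φ x v = 0 := by
  obtain ⟨-, G, hG, hcurl⟩ := h
  have hcross : ∀ (c : R3) (i : Fin 3),
      ∫ x in convexHull ℝ (T : Set R3), fderiv ℝ φ x (c ⨯₃ Pi.single i 1) = 0 := by
    intro c i
    have hae := ae_eq_zero_of_isWeakCurl_identityOn hΩ T i (hG i) (hcurl i)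
    have := hcurl i (fun y => φ y • c) (hφ.smul contDiff_const) hc.smul_right
      ((tsupport_smul_subset_left φ (fun _ => c)).trans hsupp)
    rw [setIntegral_identityOn_dotProduct_curl T hφ hsupp] at this
    rw [← this]
    refine integral_eq_zero_of_ae ?_
    filter_upwards [hae] with x hx
    simp [hx]
  -- Products with e_0 reach only the plane orthogonal to e_0; a product with e_1 supplies the
  -- missing component, so two rows suffice.
  have hv : v = (![0, -v 2, v 1] : R3) ⨯₃ Pi.single 0 1 + (![0, 0, -v 0] : R3) ⨯₃ Pi.single 1 1 := by
    ext j
    fin_cases j <;> simp [crossProduct]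
  rw [hv]
  simp only [map_add]
  rw [integral_add (integrable_fderiv_apply hφ hc _).integrableOn
    (integrable_fderiv_apply hφ hc _).integrableOn, hcross, hcross, add_zero]

/-- On a connected domain whose grid has a further element, the boundary of an element meets
the domain. -/
lemma exists_mem_frontier_gridElement {Ω : Set R3} (hΩ : IsOpen Ω) (hconn : IsConnected Ω)
    {K : Geometry.SimplicialComplex ℝ R3} (hspace : K.space = closure Ω) {T T' : Finset R3}
    (hT : T ∈ gridElements K) (hT' : T' ∈ gridElements K) (hne : T ≠ T') :
    (Ω ∩ frontier (convexHull ℝ (T : Set R3))).Nonempty := by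
  have hmeet : ∀ A ∈ gridElements K, (Ω ∩ interior (convexHull ℝ (A : Set R3))).Nonempty := by
    intro A hA
    obtain ⟨p, hp⟩ := nonempty_interior_gridElement hA
    have hpc : p ∈ closure Ω := by
      rw [← hspace]
      exact K.convexHull_subset_space hA.1 (interior_subset hp)
    rw [Set.inter_comm]
    exact mem_closure_iff.1 hpc _ isOpen_interior hp
  by_contra hcon
  have hclosed : IsClosed (convexHull ℝ (T : Set R3)) := (isCompact_convexHull_finset T).isClosed
  -- Without frontier points Ω would split into two disjoint open parts.
  have hcover : Ω ⊆ interior (convexHull ℝ (T : Set R3)) ∪ (convexHull ℝ (T : Set R3))ᶜ := by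
    intro y hy
    by_contra hy'
    rw [Set.mem_union, not_or, Set.notMem_compl_iff] at hy'
    exact hcon ⟨y, hy, subset_closure hy'.2, hy'.1⟩
  -- Otherwise the part of Ω inside T', which has positive volume, would lie in the null overlap
  -- with T.
  have hout : (Ω ∩ (convexHull ℝ (T : Set R3))ᶜ).Nonempty := by
    by_contra hempty
    have hsub : Ω ⊆ convexHull ℝ (T : Set R3) := fun y hy =>
      by_contra fun hyT => hempty ⟨y, hy, hyT⟩
    exact ((hΩ.inter isOpen_interior).measure_pos volume (hmeet T' hT')).ne'
      (measure_mono_null (Set.inter_subset_inter hsub interior_subset)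
        (volume_inter_gridElements_eq_zero hT hT' hne))
  obtain ⟨y, -, hy, hy'⟩ := hconn.isPreconnected _ _ isOpen_interior hclosed.isOpen_compl hcover
    (hmeet T hT) hout
  exact hy' (interior_subset hy)

theorem mainTheorem5 (k : ℕ) (hk : 1 ≤ k) (Ω : Set R3) (hΩ : IsOpen Ω) (hconn : IsConnected Ω)
    (K : Geometry.SimplicialComplex ℝ R3) (hK : IsTetrahedralGrid K Ω)
    (hmore : (gridElements K).Nontrivial) (fr : GridFrame K) :
    (∃ U ∈ VSymCurl Ω K fr k, U ∉ HCurl Ω) ∧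
      ∀ T ∈ gridElements K, identityOn T ∈ VSymCurl Ω K fr k ∧ identityOn T ∉ HCurl Ω := by
  have key : ∀ T ∈ gridElements K,
      identityOn T ∈ VSymCurl Ω K fr k ∧ identityOn T ∉ HCurl Ω := by
    intro T hT
    refine ⟨identityOn_mem_VSymCurl Ω fr k hT, fun hH => ?_⟩
    obtain ⟨T', hT', hne⟩ := hmore.exists_ne T
    obtain ⟨x, hxΩ, hxT⟩ :=
      exists_mem_frontier_gridElement hΩ hconn hK.space_eq hT hT' hne.symm
    obtain ⟨φ, hφ, hc, hsupp, v, hv⟩ := exists_setIntegral_fderiv_ne_zero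
      (isCompact_convexHull_finset T).isClosed (convex_convexHull ℝ _)
      (nonempty_interior_gridElement hT) hΩ hxΩ hxT
    exact hv (setIntegral_fderiv_eq_zero_of_identityOn_mem_HCurl hΩ hH hφ hc hsupp v)
  obtain ⟨T, hT⟩ := hmore.nonempty
  exact ⟨⟨identityOn T, key T hT⟩, key⟩
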